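/- Let $\theta$ be an uncountable regular cardinal, let $H_\theta$ be the collection of sets whose transitive closure has fewer than $\theta$ elements, and let $\mathcal K\in H_\theta$ be a set of uncountable regular cardinals with $\omega_1\notin\mathcal K$. Put $\lambda=\sup\mathcal K$. For a set $M$ and a set $x$ let $$\mathrm{Hull}(M,x)=\{f(x): f\in M \text{ is a function with } x\in\mathrm{dom}(f)\}.$$ For a countable elementary submodel $M\prec H_\theta$ with $\lambda\in M$, the multiple Namba game $G_0(M,\mathcal K)$ has $\omega$ rounds and is played by PI and PII as follows. Put $M_0=M$. In round $n$, PI plays a pair $(\kappa_n,\nu_n)$ with $\kappa_n\in\mathcal K\cap M_n$ and $\nu_n\in\kappa_n$; PII then has to play an ordinal $\xi_n\in\kappa_n\setminus\nu_n$ such that $M_{n+1}:=\mathrm{Hull}(M_n,\xi_n)$ satisfies $M_{n+1}\cap\omega_1=M_n\cap\omega_1$. PII loses in round $n$ if she fails to play such a $\xi_n$, and PII wins if she does not lose in any round. Then the set $\mathcal X$ of all countable $M\prec H_\theta$ with $\lambda\in M$ for which PII has a winning strategy in $G_0(M,\mathcal K)$ is a projective stationary subset of $[H_\theta]^\omega$;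 that is, $\mathcal X\subseteq[H_\theta]^\omega$ and for every stationary $S\subseteq\omega_1$ the set $\{M\in\mathcal X: M\cap\omega_1\in S\}$ is stationary in $[H_\theta]^\omega$, meaning that it meets every $C\subseteq[H_\theta]^\omega$ that is cofinal in $([H_\theta]^\omega,\subseteq)$ and closed under unions of increasing $\omega$-sequences. -/

import Mathlib

universe u

noncomputable section

namespace NambaGame

open Ordinal Cardinal

/-! ### Countable subsets, clubs and projective stationary sets -/

/-- `[X]^ω`: the countably infinite subsets of `X`. -/
def countableSubsets {α : Type*} (X : Set α) : Set (Set α) :=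
  {a | a ⊆ X ∧ a.Countable ∧ a.Infinite}

/-- `C` is club in `[X]^ω`: cofinal under inclusion and closed under unions of increasing
`ω`-sequences. -/
structure IsClubIn {α : Type*} (X : Set α) (C : Set (Set α)) : Prop where
  subset : C ⊆ countableSubsets X
  cofinal : ∀ a ∈ countableSubsets X, ∃ c ∈ C, a ⊆ c
  closed : ∀ f : ℕ → Set α, Monotone f → (∀ n, f n ∈ C) → (⋃ n, f n) ∈ C

/-- `T` is a stationary subset of `[X]^ω`. -/
def IsStationaryIn {α : Type*} (X : Set α) (T : Set (Set α)) : Prop :=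
  T ⊆ countableSubsets X ∧ ∀ C, IsClubIn X C → (T ∩ C).Nonempty

/-- The first uncountable ordinal, as a von Neumann ordinal. -/
def omegaOne : ZFSet.{u} := (ω_ 1).toZFSet

/-- `T ⊆ [X]^ω` is projective stationary: for every stationary `S ⊆ ω₁`, the set of all `M ∈ T`
with `M ∩ ω₁ ∈ S` is stationary in `[X]^ω`. -/
def IsProjectiveStationary (X : Set ZFSet.{u}) (T : Set (Set ZFSet.{u})) : Prop :=
  T ⊆ countableSubsets X ∧
    ∀ S : Set (Set.Iio (ω_ 1 : Ordinal.{u})), IsStationary S →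
      IsStationaryIn X
        {M | M ∈ T ∧ ∃ δ ∈ S, M ∩ (omegaOne : Set ZFSet.{u}) = (δ.1.toZFSet : Set ZFSet.{u})}

/-! ### `H_θ` and its elementary submodels -/

/-- `H_θ`: the sets whose transitive closure has fewer than `θ` elements. -/
def hereditary (θ : Cardinal.{u}) : Set ZFSet.{u} :=
  {x | #{y : ZFSet.{u} // Relation.TransGen (· ∈ ·) y x} < Cardinal.lift.{u + 1} θ}

/-- The relation symbols of the language of set theory: one binary symbol. -/
inductive SetRel : ℕ → Type
  | mem : SetRel 2

/-- The first-order language of set theory. -/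
def setLanguage : FirstOrder.Language.{0, 0} := ⟨fun _ => Empty, SetRel⟩

/-- `(H_θ, ∈)` as a first-order structure. -/
instance hereditaryStructure (θ : Cardinal.{u}) : setLanguage.Structure (hereditary θ) where
  funMap := fun f => nomatch f
  RelMap := fun r => match r with
    | SetRel.mem => fun v => (v 0 : ZFSet.{u}) ∈ (v 1 : ZFSet.{u})

/-- `M ≺ H_θ`. -/
def IsElementarySubmodel (θ : Cardinal.{u}) (M : Set ZFSet.{u}) : Prop :=
  ∃ N : setLanguage.ElementarySubstructure (hereditary θ),
    M = Subtype.val '' (N : Set (hereditary θ))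

/-! ### Hulls -/

/-- `f` is a function, that is, a single-valued set of ordered pairs. -/
def IsFunction (f : ZFSet.{u}) : Prop :=
  (∀ p ∈ f, ∃ a b, p = ZFSet.pair a b) ∧
    ∀ a b c, ZFSet.pair a b ∈ f → ZFSet.pair a c ∈ f → b = c

/-- `Hull(M, x) = {f(x) : f ∈ M is a function with x ∈ dom f}`. -/
def hull (M : Set ZFSet.{u}) (x : ZFSet.{u}) : Set ZFSet.{u} :=
  {y | ∃ f ∈ M, IsFunction f ∧ ZFSet.pair x y ∈ f}

/-! ### The multiple Namba game -/

/-- `κ` is an uncountable regular cardinal (a von Neumann initial ordinal). -/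
def IsUncountableRegular (κ : ZFSet.{u}) : Prop :=
  ∃ c : Cardinal.{u}, ℵ₀ < c ∧ c.IsRegular ∧ κ = c.ord.toZFSet

/-- The models of a run: `M_0 = M` and `M_{n+1} = Hull(M_n, ξ_n)`. -/
def runModel (M : Set ZFSet.{u}) (ξ : ℕ → ZFSet.{u}) : ℕ → Set ZFSet.{u}
  | 0 => M
  | n + 1 => hull (runModel M ξ n) (ξ n)

/-- When the current model is `N`, player I may play `(κ, ν)`: `κ ∈ K ∩ N` and `ν ∈ κ`. -/
def LegalI (K : ZFSet.{u}) (N : Set ZFSet.{u}) (m : ZFSet.{u} × ZFSet.{u}) : Prop :=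
  m.1 ∈ K ∧ m.1 ∈ N ∧ m.2 ∈ m.1

/-- When the current model is `N` and player I has played `(κ, ν)`, player II may answer `ξ`:
`ξ ∈ κ \ ν` and `Hull(N, ξ) ∩ ω₁ = N ∩ ω₁`. -/
def LegalII (N : Set ZFSet.{u}) (m : ZFSet.{u} × ZFSet.{u}) (ξ : ZFSet.{u}) : Prop :=
  ξ ∈ m.1 \ m.2 ∧ hull N ξ ∩ (omegaOne : Set ZFSet.{u}) = N ∩ (omegaOne : Set ZFSet.{u})

/-- A strategy for player II: the answer to the moves that player I has made so far (the current
one included, in the order in which they were played). -/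
abbrev Strategy : Type (u + 1) := List (ZFSet.{u} × ZFSet.{u}) → ZFSet.{u}

/-- The answers given by the strategy `s` when player I plays `p 0, p 1, …`. -/
def Strategy.answers (s : Strategy.{u}) (p : ℕ → ZFSet.{u} × ZFSet.{u}) (n : ℕ) : ZFSet.{u} :=
  s ((List.range (n + 1)).map p)

/-- `s` is winning for player II in the game on `(M, K)`: as long as player I has obeyed the rules
up to and including round `n`, player II does not lose in round `n`. Only `p 0, …, p n` matter for
round `n`, so this also covers the plays in which player I cannot move at some point. -/
def Strategy.IsWinning (s : Strategy.{u}) (M : Set ZFSet.{u}) (K : ZFSet.{u}) : Prop :=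
  ∀ (p : ℕ → ZFSet.{u} × ZFSet.{u}) (n : ℕ),
    (∀ i ≤ n, LegalI K (runModel M (s.answers p) i) (p i)) →
      LegalII (runModel M (s.answers p) n) (p n) (s.answers p n)

/-- The countable `M ≺ H_θ` with `sup K ∈ M` (the supremum of a set of ordinals is its union) for
which player II has a winning strategy in the multiple Namba game on `(M, K)`. -/
def winningModels (θ : Cardinal.{u}) (K : ZFSet.{u}) : Set (Set ZFSet.{u}) :=
  {M | M.Countable ∧ IsElementarySubmodel θ M ∧ ZFSet.sUnion K ∈ M ∧
    ∃ s : Strategy.{u}, s.IsWinning M K}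

end NambaGame

end

namespace NambaGame

open Ordinal Cardinal Set

/-! ### Closure properties of `H_θ` -/

/-! Fix a club `C` and a stationary `S`. Code everything required of a model into one
countable-valued operation `G` on finite sets: countable subsets of `H_θ` closed under `G` are
elementary, lie in `C`, contain `sup K`, and are closed under applying functions and under `y ↦ sup
K × {y}`. For `δ < ω₁` the candidate is `M = cl_G(δ)`.

In place of the hulls, consider `cl_G(δ ∪ answers)`, which contains them. Player II survives as long
as this closure adds no countable ordinal outside `δ`. Failure is visible at a finite stage, so the
auxiliary game is open for player I, whose winning strategies are well-founded trees (`LosingTree`).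
If there is no tree at the root, player II can keep it so by safe answers (`exists_answer`), and
this wins the original game (`isWinning_safeStrategy`).

It remains to find `δ ∈ S` without a tree (`exists_bounds`). Choose a tree for each `δ` that has
one. After a list of answers `l`, at most `ℵ₁` lower bounds are demanded by all these trees
together. Every `κ ∈ K` is regular and larger than `ω₁`, so a single `B κ l ∈ κ` meets all of those
that lie in `κ`. The function `B` does not depend on `δ`. By stationarity some `δ ∈ S` contains
every countable ordinal in its closure `X` under `G` and `B`. Playing the values of `B` against a
tree for `δ` keeps the run inside `X`, so no leaf of the tree can be reached, contradicting
well-foundedness. -/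

theorem mem_hereditary_iff {θ : Cardinal.{u}} {x : ZFSet.{u}} :
    x ∈ hereditary θ ↔ #{y | Relation.TransGen (· ∈ ·) y x} < Cardinal.lift.{u + 1} θ :=
  Iff.rfl

theorem mem_hereditary_of_mem {θ : Cardinal.{u}} {x y : ZFSet.{u}} (hx : x ∈ hereditary θ)
    (hy : y ∈ x) : y ∈ hereditary θ := by
  refine lt_of_le_of_lt ?_ (mem_hereditary_iff.1 hx)
  exact Cardinal.mk_le_mk_of_subset (s := {z | Relation.TransGen (· ∈ ·) z y})
    (t := {z | Relation.TransGen (· ∈ ·) z x}) fun z hz => Relation.TransGen.tail hz hy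

theorem mk_mem_lt_of_mem_hereditary {θ : Cardinal.{u}} {x : ZFSet.{u}} (hx : x ∈ hereditary θ) :
    #{y | y ∈ x} < Cardinal.lift.{u + 1} θ := by
  refine lt_of_le_of_lt ?_ (mem_hereditary_iff.1 hx)
  exact Cardinal.mk_le_mk_of_subset (s := {z | z ∈ x})
    (t := {z | Relation.TransGen (· ∈ ·) z x}) fun z hz => Relation.TransGen.single hz

/-- The transitive closure of `x` is the union of `{y} ∪ TC(y)` over `y ∈ x`: fewer than `θ` sets,
each of size less than `θ`, so regularity applies. -/
theorem mem_hereditary_of_forall_mem {θ : Cardinal.{u}} (hθ : θ.IsRegular) {x : ZFSet.{u}}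
    (hx : #{y | y ∈ x} < Cardinal.lift.{u + 1} θ) (h : ∀ y ∈ x, y ∈ hereditary θ) :
    x ∈ hereditary θ := by
  have hreg : (Cardinal.lift.{u + 1} θ).IsRegular := hθ.lift
  have key : #(⋃ y ∈ {y | y ∈ x}, insert y {z | Relation.TransGen (· ∈ ·) z y} : Set ZFSet.{u})
      < Cardinal.lift.{u + 1} θ := by
    rw [Cardinal.card_biUnion_lt_iff_forall_of_isRegular hreg hx]
    intro y hy
    refine lt_of_le_of_lt (Cardinal.mk_insert_le) ?_
    exact Cardinal.add_lt_of_lt hreg.aleph0_le (h y hy) (by simpa using hreg.nat_lt 1)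
  refine lt_of_le_of_lt ?_ key
  refine Cardinal.mk_le_mk_of_subset (s := {z | Relation.TransGen (· ∈ ·) z x}) fun z hz => ?_
  simp only [mem_iUnion]
  rcases (Relation.TransGen.tail'_iff.1 hz) with ⟨y, hzy, hyx⟩
  refine ⟨y, hyx, ?_⟩
  rcases Relation.reflTransGen_iff_eq_or_transGen.1 hzy with rfl | h
  · exact mem_insert _ _
  · exact mem_insert_of_mem _ h

theorem mem_hereditary_of_countable {θ : Cardinal.{u}} (hθ : θ.IsRegular) (hθ' : ℵ₀ < θ)
    {x : ZFSet.{u}} (hx : {y | y ∈ x}.Countable) (h : ∀ y ∈ x, y ∈ hereditary θ) :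
    x ∈ hereditary θ := by
  refine mem_hereditary_of_forall_mem hθ (lt_of_le_of_lt hx.le_aleph0 ?_) h
  simpa using hθ'

theorem pair_mem_hereditary {θ : Cardinal.{u}} (hθ : θ.IsRegular) (hθ' : ℵ₀ < θ)
    {x y : ZFSet.{u}} (hx : x ∈ hereditary θ) (hy : y ∈ hereditary θ) :
    ZFSet.pair x y ∈ hereditary θ := by
  have upair : ∀ {a b : ZFSet.{u}}, a ∈ hereditary θ → b ∈ hereditary θ →
      ({a, b} : ZFSet) ∈ hereditary θ := by
    intro a b ha hb
    refine mem_hereditary_of_countable hθ hθ' ?_ ?_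
    · have : {y | y ∈ ({a, b} : ZFSet)} = {a, b} := by ext; simp
      rw [this]
      exact (Set.toFinite _).countable
    · intro c hc
      rcases ZFSet.mem_pair.1 hc with rfl | rfl <;> assumption
  have hs : ({x} : ZFSet) ∈ hereditary θ := by
    rw [← ZFSet.pair_eq_singleton]; exact upair hx hx
  exact upair hs (upair hx hy)

theorem prod_singleton_mem_hereditary {θ : Cardinal.{u}} (hθ : θ.IsRegular) (hθ' : ℵ₀ < θ)
    {x y : ZFSet.{u}} (hx : x ∈ hereditary θ) (hy : y ∈ hereditary θ) :
    ZFSet.prod x {y} ∈ hereditary θ := by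
  refine mem_hereditary_of_forall_mem hθ ?_ ?_
  · refine lt_of_le_of_lt ?_ (mk_mem_lt_of_mem_hereditary hx)
    refine le_trans (Cardinal.mk_le_mk_of_subset ?_)
      (Cardinal.mk_image_le (s := {a | a ∈ x}) (f := fun a => ZFSet.pair a y))
    intro z hz
    obtain ⟨a, ha, b, hb, rfl⟩ := ZFSet.mem_prod.1 hz
    rw [ZFSet.mem_singleton.1 hb]
    exact ⟨a, ha, rfl⟩
  · intro z hz
    obtain ⟨a, ha, b, hb, rfl⟩ := ZFSet.mem_prod.1 hz
    rw [ZFSet.mem_singleton.1 hb]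
    exact pair_mem_hereditary hθ hθ' (mem_hereditary_of_mem hx ha) hy

theorem sUnion_mem_hereditary {θ : Cardinal.{u}} {x : ZFSet.{u}} (hx : x ∈ hereditary θ) :
    ZFSet.sUnion x ∈ hereditary θ := by
  refine lt_of_le_of_lt ?_ (mem_hereditary_iff.1 hx)
  refine Cardinal.mk_le_mk_of_subset (s := {z | Relation.TransGen (· ∈ ·) z (ZFSet.sUnion x)})
    (t := {z | Relation.TransGen (· ∈ ·) z x}) fun z hz => ?_
  rcases (Relation.TransGen.tail'_iff.1 hz) with ⟨y, hzy, hyx⟩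
  obtain ⟨w, hw, hyw⟩ := ZFSet.mem_sUnion.1 hyx
  exact Relation.TransGen.tail (Relation.TransGen.tail' hzy hyw) hw

theorem countable_mem_toZFSet {o : Ordinal.{u}} (ho : o < ω_ 1) : {y | y ∈ o.toZFSet}.Countable := by
  have h1 : {y | y ∈ o.toZFSet} = toZFSet '' Set.Iio o := Ordinal.coe_toZFSet
  rw [h1]
  refine Set.Countable.image ?_ _
  rw [← Cardinal.le_aleph0_iff_set_countable, Cardinal.mk_Iio_ordinal]
  have h : o.card < ℵ_ 1 := by
    rwa [← Cardinal.lt_ord, Cardinal.ord_aleph]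
  rw [← Cardinal.lift_aleph0.{u + 1, u}, Cardinal.lift_le]
  rwa [← Cardinal.succ_aleph0, Order.lt_succ_iff] at h

theorem toZFSet_mem_hereditary {θ : Cardinal.{u}} (hθ : θ.IsRegular) (hθ' : ℵ₀ < θ)
    {o : Ordinal.{u}} (ho : o < ω_ 1) : o.toZFSet ∈ hereditary θ := by
  induction o using WellFoundedLT.induction with
  | _ o ih =>
    refine mem_hereditary_of_countable hθ hθ' (countable_mem_toZFSet ho) fun y hy => ?_
    obtain ⟨a, ha, rfl⟩ := mem_toZFSet_iff.1 hy
    exact ih a ha (ha.trans ho)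

theorem omegaOne_subset_hereditary {θ : Cardinal.{u}} (hθ : θ.IsRegular) (hθ' : ℵ₀ < θ) :
    (omegaOne : Set ZFSet.{u}) ⊆ hereditary θ := by
  intro y hy
  obtain ⟨a, ha, rfl⟩ := mem_toZFSet_iff.1 (show y ∈ (ω_ 1).toZFSet from hy)
  exact toZFSet_mem_hereditary hθ hθ' ha

theorem countableSubsets_hereditary_nonempty {θ : Cardinal.{u}} (hθ : θ.IsRegular)
    (hθ' : ℵ₀ < θ) : (countableSubsets (hereditary θ)).Nonempty := by
  have hlt : (ω : Ordinal.{u}) < ω_ 1 := omega0_lt_omega_one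
  refine ⟨((ω : Ordinal.{u}).toZFSet : Set ZFSet.{u}),
    fun y hy => mem_hereditary_of_mem (toZFSet_mem_hereditary hθ hθ' hlt) hy,
    countable_mem_toZFSet hlt, ?_⟩
  rw [Ordinal.coe_toZFSet]
  refine Set.Infinite.image toZFSet_injective.injOn ?_
  exact Set.infinite_of_injective_forall_mem (f := fun n : ℕ => (n : Ordinal.{u}))
    Nat.cast_injective (fun n => natCast_lt_omega0 n)

/-! ### Closure under set-valued operations on finite sets -/

/-- `X` is closed under the operation `G`. -/
def ClosedUnder {α : Type*} (G : Finset α → Set α) (X : Set α) : Prop :=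
  ∀ e : Finset α, (e : Set α) ⊆ X → G e ⊆ X

/-- The least superset of `X` that is closed under `G`. -/
def closureUnder {α : Type*} (G : Finset α → Set α) (X : Set α) : Set α :=
  ⋂₀ {Y | X ⊆ Y ∧ ClosedUnder G Y}

section Closure

variable {α : Type*} {G G' : Finset α → Set α} {X Y : Set α}

theorem subset_closureUnder : X ⊆ closureUnder G X :=
  subset_sInter fun _ h => h.1

theorem closedUnder_closureUnder : ClosedUnder G (closureUnder G X) :=
  fun e he => subset_sInter fun _ hY => hY.2 e (he.trans (sInter_subset_of_mem hY))

theorem closureUnder_subset (h : X ⊆ Y) (hY : ClosedUnder G Y) : closureUnder G X ⊆ Y :=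
  sInter_subset_of_mem ⟨h, hY⟩

theorem ClosedUnder.mono (hY : ClosedUnder G' Y) (h : ∀ e, G e ⊆ G' e) : ClosedUnder G Y :=
  fun e he => (h e).trans (hY e he)

theorem closedUnder_iUnion {ι : Type*} [Nonempty ι] {f : ι → Set α}
    (hd : Directed (· ⊆ ·) f) (hf : ∀ i, ClosedUnder G (f i)) : ClosedUnder G (⋃ i, f i) := by
  intro e he
  obtain ⟨i, hi⟩ := hd.exists_mem_subset_of_finset_subset_biUnion he
  exact (hf i e hi).trans (subset_iUnion f i)

/-- The closure is reached in `ω` steps, since a finite subset of the union already lies in one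
stage; each stage is countable because a countable set has countably many finite subsets. -/
theorem countable_closureUnder (hG : ∀ e, (G e).Countable) (hX : X.Countable) :
    (closureUnder G X).Countable := by
  let Y : ℕ → Set α := fun n =>
    Nat.rec X (fun _ Z => Z ∪ ⋃ e ∈ {e : Finset α | (e : Set α) ⊆ Z}, G e) n
  have hsucc : ∀ n, Y (n + 1) = Y n ∪ ⋃ e ∈ {e : Finset α | (e : Set α) ⊆ Y n}, G e := fun _ => rfl
  have hc : ∀ n, (Y n).Countable := by
    intro n
    induction n with
    | zero => exact hX
    | succ n ih =>
      rw [hsucc]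
      refine ih.union (Countable.biUnion ?_ fun e _ => hG e)
      refine countable_of_injective_of_countable_image (f := ((↑) : Finset α → Set α))
        Finset.coe_injective.injOn ((countable_ofPred_finite_subset ih).mono ?_)
      rintro _ ⟨e, he, rfl⟩
      exact ⟨e.finite_toSet, he⟩
  have hmono : Monotone Y := monotone_nat_of_le_succ fun n => by
    rw [hsucc]; exact subset_union_left
  refine (countable_iUnion hc).mono (closureUnder_subset (subset_iUnion Y 0) ?_)
  intro e he
  obtain ⟨n, hn⟩ := (hmono.directed_le).exists_mem_subset_of_finset_subset_biUnion he
  refine Subset.trans ?_ (subset_iUnion Y (n + 1))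
  rw [hsucc]
  exact (subset_biUnion_of_mem (u := G) (show e ∈ {e : Finset α | (e : Set α) ⊆ Y n} from hn)).trans
    subset_union_right

end Closure

/-! ### Operations that generate a club -/

/-- From a choice of supersets, an operation that is monotone on finite subsets of `A`. -/
def clubOperation {α : Type*} (c : Set α → Set α) (A : Set α) (e : Finset α) : Set α :=
  c ((A ∩ e) ∪ ⋃ d : {d : Finset α // d ⊂ e}, clubOperation c A d.1)
termination_by e.card
decreasing_by exact Finset.card_lt_card d.2

/-- Enumerate a closed countable `X` and let `e n` be its finite initial parts. Then `X` is the
increasing union of the values `F (e n)`, all of which are in `C`. -/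
theorem IsClubIn.exists_operation {α : Type*} {A : Set α} {C : Set (Set α)} (hC : IsClubIn A C)
    (hA : (countableSubsets A).Nonempty) :
    ∃ F : Finset α → Set α, (∀ e, F e ∈ C) ∧
      ∀ X ⊆ A, X.Countable → ClosedUnder F X → X ∈ C := by
  obtain ⟨a₀, ha₀⟩ := hA
  have hex : ∀ a : Set α, ∃ c ∈ C, a ⊆ A → a.Countable → a ⊆ c := by
    intro a
    by_cases h : a ⊆ A ∧ a.Countable
    -- Adding `a₀` makes the set infinite, as cofinality only concerns countably infinite sets.
    · obtain ⟨c, hc, hac⟩ := hC.cofinal (a ∪ a₀) ⟨union_subset h.1 ha₀.1, h.2.union ha₀.2.1,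
        ha₀.2.2.mono subset_union_right⟩
      exact ⟨c, hc, fun _ _ => subset_union_left.trans hac⟩
    · obtain ⟨c, hc, -⟩ := hC.cofinal a₀ ha₀
      exact ⟨c, hc, fun h1 h2 => absurd ⟨h1, h2⟩ h⟩
  choose c hc hac using hex
  have hF : ∀ e, clubOperation c A e ∈ C := fun e => by
    rw [clubOperation]; exact hc _
  have hsub : ∀ e : Finset α, (A ∩ e) ∪ ⋃ d : {d : Finset α // d ⊂ e}, clubOperation c A d.1
      ⊆ clubOperation c A e := by
    intro e
    conv_rhs => rw [clubOperation]
    refine hac _ (union_subset inter_subset_left (iUnion_subset fun d => (hC.subset (hF d)).1)) ?_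
    refine ((Finset.countable_toSet e).mono inter_subset_right).union ?_
    have : Finite {d : Finset α // d ⊂ e} :=
      ((Finset.finite_toSet e.powerset).subset fun d hd => by
        simpa using (Finset.ssubset_iff_subset_ne.1 hd).1)
    exact countable_iUnion fun d => (hC.subset (hF d)).2.1
  have hmono : Monotone (clubOperation c A) := by
    intro d e hde
    rcases hde.eq_or_ssubset with rfl | h
    · exact le_rfl
    · exact (subset_iUnion_of_subset ⟨d, h⟩ Subset.rfl).trans (subset_union_right.trans (hsub e))
  refine ⟨clubOperation c A, hF, fun X hXA hX hcl => ?_⟩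
  have hne : X.Nonempty :=
    ((hC.subset (hF ∅)).2.2.mono (hcl ∅ (by simp))).nonempty
  obtain ⟨x, rfl⟩ := hX.exists_eq_range hne
  classical
  let e : ℕ → Finset α := fun n => (Finset.range n).image x
  have he : Monotone e := fun m n h => Finset.image_subset_image (Finset.range_mono h)
  have : range x = ⋃ n, clubOperation c A (e n) := by
    refine Subset.antisymm ?_ (iUnion_subset fun n => hcl _ ?_)
    · rintro _ ⟨n, rfl⟩
      refine mem_iUnion.2 ⟨n + 1, hsub _ (Or.inl ⟨hXA ⟨n, rfl⟩, ?_⟩)⟩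
      exact Finset.mem_coe.2 (Finset.mem_image.2 ⟨n, by simp, rfl⟩)
    · intro y hy
      obtain ⟨i, -, rfl⟩ := Finset.mem_image.1 (Finset.mem_coe.1 hy)
      exact ⟨i, rfl⟩
  rw [this]
  exact hC.closed _ (hmono.comp he) fun n => hF _

/-! ### Operations that generate elementary submodels -/

/-- The operation collects the values of Skolem functions for the countably many formulas; closed
sets then pass the Tarski–Vaught test. -/
theorem exists_operation_elementary {L : FirstOrder.Language.{0, 0}} [L.IsRelational]
    (hL : L.card ≤ ℵ₀) (M : Type*) [L.Structure M] [Nonempty M] :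
    ∃ F : Finset M → Set M, (∀ e, (F e).Countable) ∧
      ∀ X, ClosedUnder F X → ∃ N : L.ElementarySubstructure M, (N : Set M) = X := by
  classical
  have hcount : Countable (Σ n, L.BoundedFormula Empty n) := by
    rw [← Cardinal.mk_le_aleph0_iff]
    refine FirstOrder.Language.BoundedFormula.card_le.trans ?_
    simpa using hL
  have hcount' : Countable (Σ n, L.BoundedFormula Empty (n + 1)) := by
    refine Function.Injective.countable (β := Σ n, L.BoundedFormula Empty n)
      (f := fun p => ⟨p.1 + 1, p.2⟩) ?_
    rintro ⟨m, φ⟩ ⟨n, ψ⟩ h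
    obtain rfl : m = n := by simpa using congrArg Sigma.fst h
    simpa using h
  let w : ∀ p : (Σ n, L.BoundedFormula Empty (n + 1)), (Fin p.1 → M) → M := fun p x =>
    Classical.epsilon fun a => p.2.Realize default (Fin.snoc x a : Fin (p.1 + 1) → M)
  refine ⟨fun e => ⋃ p, range fun x : Fin p.1 → e => w p (Subtype.val ∘ x),
    fun e => countable_iUnion fun p => countable_range _, fun X hX => ?_⟩
  refine ⟨FirstOrder.Language.Substructure.toElementarySubstructure
    ⟨X, fun f => isEmptyElim f⟩ ?_, rfl⟩
  intro n φ x a ha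
  let e : Finset M := Finset.univ.image fun i => (x i).1
  have he : (e : Set M) ⊆ X := by
    intro y hy
    obtain ⟨i, -, rfl⟩ := Finset.mem_image.1 (Finset.mem_coe.1 hy)
    exact (x i).2
  have hw : w ⟨n, φ⟩ (Subtype.val ∘ x) ∈ X := by
    refine hX e he (mem_iUnion.2 ⟨⟨n, φ⟩, fun i => ⟨(x i).1, ?_⟩, rfl⟩)
    exact Finset.mem_image_of_mem _ (Finset.mem_univ i)
  exact ⟨⟨_, hw⟩, Classical.epsilon_spec (p := fun a => φ.Realize default
    (Fin.snoc (Subtype.val ∘ x) a : Fin (n + 1) → M)) ⟨a, ha⟩⟩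

/-! ### Closure points below `ω₁` and bounds below larger regular cardinals -/

theorem omegaOne_eq_image : (omegaOne : Set ZFSet.{u}) = toZFSet '' Set.Iio (ω_ 1) :=
  Ordinal.coe_toZFSet

theorem toZFSet_subset_omegaOne {o : Ordinal.{u}} (ho : o < ω_ 1) :
    (o.toZFSet : Set ZFSet.{u}) ⊆ omegaOne :=
  fun _ hy => toZFSet_monotone ho.le hy

theorem exists_gt_inter_omegaOne_subset {T : Set ZFSet.{u}} (hT : T.Countable)
    {a : Ordinal.{u}} (ha : a < ω_ 1) :
    ∃ b < ω_ 1, a < b ∧ T ∩ omegaOne ⊆ (b.toZFSet : Set ZFSet.{u}) := by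
  have hsucc : ∀ c : Ordinal.{u}, c < ω_ 1 → c + 1 < ω_ 1 := fun c hc =>
    (isSuccLimit_omega 1).add_one_lt hc
  have hc : Countable ↥(T ∩ omegaOne) := (hT.mono inter_subset_left).to_subtype
  have hr : ∀ t : ↥(T ∩ omegaOne), t.1.rank + 1 < ω_ 1 := by
    rintro ⟨t, -, ht⟩
    obtain ⟨c, hc, rfl⟩ := omegaOne_eq_image ▸ ht
    simpa using hsucc c hc
  refine ⟨max (a + 1) (⨆ t : ↥(T ∩ omegaOne), t.1.rank + 1),
    max_lt (hsucc a ha) (iSup_lt_omega_one hr), lt_max_of_lt_left (lt_add_one a), ?_⟩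
  intro t ht
  obtain ⟨c, hc, hct⟩ := omegaOne_eq_image ▸ ht.2
  have h1 : t.rank + 1 ≤ ⨆ t : ↥(T ∩ omegaOne), t.1.rank + 1 :=
    Ordinal.le_iSup (fun t : ↥(T ∩ omegaOne) => t.1.rank + 1) ⟨t, ht⟩
  refine mem_toZFSet_iff.2 ⟨c, ?_, hct⟩
  subst hct
  refine lt_max_of_lt_right (lt_of_lt_of_le ?_ h1)
  simp

theorem isClub_closurePoints {G : Finset ZFSet.{u} → Set ZFSet.{u}}
    (hG : ∀ e, (G e).Countable) :
    IsClub {δ : Set.Iio (ω_ 1 : Ordinal.{u}) |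
      closureUnder G (δ.1.toZFSet : Set ZFSet.{u}) ∩ omegaOne ⊆ δ.1.toZFSet} := by
  -- Used twice: with `y = x` for closedness, and with `d` an orbit of a step function `g` for
  -- unboundedness. The closure of the limit is the union of the closures below it.
  have key : ∀ (d : Set (Set.Iio (ω_ 1 : Ordinal.{u}))), d.Nonempty →
      ∀ a : Set.Iio (ω_ 1 : Ordinal.{u}), IsLUB d a →
      (∀ x ∈ d, ∃ y ∈ d, closureUnder G (x.1.toZFSet : Set ZFSet.{u}) ∩ omegaOne ⊆ y.1.toZFSet) →
      closureUnder G (a.1.toZFSet : Set ZFSet.{u}) ∩ omegaOne ⊆ a.1.toZFSet := by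
    intro d hd a ha h
    have hne : Nonempty d := hd.to_subtype
    have hmono : ∀ x y : Set.Iio (ω_ 1 : Ordinal.{u}), x ≤ y →
        closureUnder G (x.1.toZFSet : Set ZFSet.{u}) ⊆ closureUnder G y.1.toZFSet :=
      fun x y hxy => closureUnder_subset (Subset.trans (fun z hz => toZFSet_monotone hxy hz)
        subset_closureUnder) closedUnder_closureUnder
    have hsub : closureUnder G (a.1.toZFSet : Set ZFSet.{u}) ⊆
        ⋃ x : d, closureUnder G (x.1.1.toZFSet : Set ZFSet.{u}) := by
      refine closureUnder_subset ?_ (closedUnder_iUnion ?_ fun _ => closedUnder_closureUnder)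
      · intro z hz
        obtain ⟨b, hb, rfl⟩ := mem_toZFSet_iff.1 hz
        obtain ⟨x, hx, hbx⟩ := (lt_isLUB_iff ha).1
          (show (⟨b, hb.trans a.2⟩ : Set.Iio (ω_ 1 : Ordinal.{u})) < a from hb)
        exact mem_iUnion.2 ⟨⟨x, hx⟩, subset_closureUnder (toZFSet_mem_toZFSet_iff.2 hbx)⟩
      · intro x y
        rcases le_total x.1 y.1 with hxy | hxy
        · exact ⟨y, hmono _ _ hxy, Subset.rfl⟩
        · exact ⟨x, Subset.rfl, hmono _ _ hxy⟩
    rintro z ⟨hz, hz1⟩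
    obtain ⟨x, hx⟩ := mem_iUnion.1 (hsub hz)
    obtain ⟨y, hy, hxy⟩ := h x.1 x.2
    exact toZFSet_monotone (show y.1 ≤ a.1 from ha.1 hy) (hxy ⟨hx, hz1⟩)
  constructor
  · intro d hdD hd _ a ha
    exact key d hd a ha fun x hx => ⟨x, hx, hdD hx⟩
  · intro a
    have hstep : ∀ x : Set.Iio (ω_ 1 : Ordinal.{u}), ∃ y : Set.Iio (ω_ 1 : Ordinal.{u}), x < y ∧
        closureUnder G (x.1.toZFSet : Set ZFSet.{u}) ∩ omegaOne ⊆ y.1.toZFSet := by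
      intro x
      obtain ⟨b, hb, hxb, h⟩ := exists_gt_inter_omegaOne_subset
        (countable_closureUnder hG (countable_mem_toZFSet x.2)) x.2
      exact ⟨⟨b, hb⟩, hxb, h⟩
    choose g hg hg' using hstep
    have hs : ⨆ n : ℕ, (g^[n] a).1 < ω_ 1 := iSup_lt_omega_one fun n => (g^[n] a).2
    refine ⟨⟨_, hs⟩, ?_, Ordinal.le_iSup (fun n : ℕ => (g^[n] a).1) 0⟩
    refine key (range fun n : ℕ => g^[n] a) (range_nonempty _) _ ⟨?_, ?_⟩ ?_
    · rintro _ ⟨n, rfl⟩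
      exact Ordinal.le_iSup (fun n : ℕ => (g^[n] a).1) n
    · intro b hb
      exact Ordinal.iSup_le fun n => hb ⟨n, rfl⟩
    · rintro _ ⟨n, rfl⟩
      refine ⟨_, ⟨n + 1, rfl⟩, ?_⟩
      simp only [Function.iterate_succ_apply']
      exact hg' _

/-- A regular `κ` above `ω₁` has cofinality greater than `ℵ₁`, so the supremum of `ℵ₁` many of its
elements stays in `κ`. This is where `ω₁ ∉ K` enters. -/
theorem exists_forall_notMem {κ : ZFSet.{u}} (hκ : IsUncountableRegular κ) (hκ₁ : κ ≠ omegaOne)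
    (ν : Set.Iio (ω_ 1 : Ordinal.{u}) → ZFSet.{u}) :
    ∃ ξ ∈ κ, ∀ δ, ν δ ∈ κ → ξ ∉ ν δ := by
  obtain ⟨c, hc, hreg, rfl⟩ := hκ
  have hc1 : ℵ_ 1 < c := by
    refine lt_of_le_of_ne ?_ ?_
    · rw [← succ_aleph0]; exact Order.succ_le_of_lt hc
    · rintro rfl
      exact hκ₁ (by rw [ord_aleph]; rfl)
  have hex : ∀ δ, ∃ b < c.ord, ν δ ∈ c.ord.toZFSet → ν δ = b.toZFSet := by
    intro δ
    by_cases h : ν δ ∈ c.ord.toZFSet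
    · obtain ⟨b, hb, hbν⟩ := mem_toZFSet_iff.1 h
      exact ⟨b, hb, fun _ => hbν.symm⟩
    · exact ⟨0, hreg.ord_pos, fun h' => absurd h' h⟩
  choose f hf hfν using hex
  have hsup : ⨆ δ, f δ < c.ord := by
    refine Ordinal.lift_iSup_lt_of_lt_cof ?_ hf
    rw [← Ordinal.lift_cof, hreg.cof_ord, Cardinal.mk_Iio_ordinal, card_omega]
    simpa using hc1
  refine ⟨(⨆ δ, f δ).toZFSet, toZFSet_mem_toZFSet_iff.2 hsup, fun δ h => ?_⟩
  rw [hfν δ h, toZFSet_mem_toZFSet_iff, not_lt]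
  exact Ordinal.le_iSup f δ

/-! ### The auxiliary game on lists of answers -/

/-- A well-founded strategy tree for player I which, after player II has given the answers in `l`
(the latest one first), forces a countable ordinal outside `δ` into the closure of `δ` and the
answers under `G`. -/
inductive LosingTree (G : Finset ZFSet.{u} → Set ZFSet.{u}) (K : ZFSet.{u}) (δ : Set ZFSet.{u}) :
    List ZFSet.{u} → Type (u + 1)
  | escape (l : List ZFSet.{u}) (h : ¬ closureUnder G (δ ∪ {x | x ∈ l}) ∩ omegaOne ⊆ δ) :
      LosingTree G K δ l
  | move (l : List ZFSet.{u}) (κ ν : ZFSet.{u}) (hκ : κ ∈ K)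
      (hκl : κ ∈ closureUnder G (δ ∪ {x | x ∈ l})) (hν : ν ∈ κ)
      (h : ∀ ξ ∈ κ \ ν, LosingTree G K δ (ξ :: l)) : LosingTree G K δ l

section LosingTree

variable {G : Finset ZFSet.{u} → Set ZFSet.{u}} {K : ZFSet.{u}} {δ : Set ZFSet.{u}}

open Classical in
/-- The part of the tree that is left after the answers in `l`, if these obey the rules. -/
noncomputable def LosingTree.subtree (T : LosingTree G K δ []) :
    ∀ l : List ZFSet.{u}, Option (LosingTree G K δ l)
  | [] => some T
  | ξ :: l => match T.subtree l with
    | some (.move _ κ ν _ _ _ h) => if hξ : ξ ∈ κ \ ν then some (h ξ hξ) else none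
    | _ => none

/-- The lower bound that player I demands at the root of the tree. -/
def LosingTree.lowerBound {l : List ZFSet.{u}} : Option (LosingTree G K δ l) → ZFSet.{u}
  | some (.move _ _ ν _ _ _ _) => ν
  | _ => ∅

/-- Descend through the tree with answers from `X`. Every cardinal played lies in `X`, so `hB`
supplies the next answer, and a leaf would put a countable ordinal outside `δ` into `X`. Induction
on the tree replaces the infinite descent; `ht` records that the current node belongs to `T`. -/
theorem LosingTree.false_of_closedUnder {X : Set ZFSet.{u}} (hδX : δ ⊆ X) (hX : ClosedUnder G X)
    (hXδ : X ∩ omegaOne ⊆ δ) (T : LosingTree G K δ [])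
    (hB : ∀ κ ∈ K, κ ∈ X → ∀ l : List ZFSet.{u}, (∀ x ∈ l, x ∈ X) → ∃ ξ ∈ X, ξ ∈ κ ∧
      (lowerBound (T.subtree l) ∈ κ → ξ ∉ lowerBound (T.subtree l)))
    {l : List ZFSet.{u}} (t : LosingTree G K δ l) (ht : T.subtree l = some t)
    (hl : ∀ x ∈ l, x ∈ X) : False := by
  have hcl : ∀ l : List ZFSet.{u}, (∀ x ∈ l, x ∈ X) →
      closureUnder G (δ ∪ {x | x ∈ l}) ⊆ X :=
    fun l hl => closureUnder_subset (union_subset hδX hl) hX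
  induction t with
  | escape l h => exact h ((inter_subset_inter_left _ (hcl l hl)).trans hXδ)
  | move l κ ν hκ hκl hν h ih =>
    obtain ⟨ξ, hξX, hξκ, hξ⟩ := hB κ hκ (hcl l hl hκl) l hl
    have hlb : lowerBound (T.subtree l) = ν := by rw [ht]; rfl
    rw [hlb] at hξ
    have hmem : ξ ∈ κ \ ν := ZFSet.mem_sdiff.2 ⟨hξκ, hξ hν⟩
    refine ih ξ hmem ?_ (by simpa using ⟨hξX, hl⟩)
    rw [subtree, ht]
    exact dif_pos hmem

theorem exists_bounds (G : Finset ZFSet.{u} → Set ZFSet.{u})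
    (hK : ∀ κ ∈ K, IsUncountableRegular κ) (hω₁ : omegaOne ∉ K) :
    ∃ B : ZFSet.{u} → List ZFSet.{u} → ZFSet.{u},
      ∀ δ : Set.Iio (ω_ 1 : Ordinal.{u}), ∀ X : Set ZFSet.{u}, (δ.1.toZFSet : Set ZFSet.{u}) ⊆ X →
        ClosedUnder G X → X ∩ omegaOne ⊆ δ.1.toZFSet →
        (∀ κ ∈ K, κ ∈ X → ∀ l : List ZFSet.{u}, (∀ x ∈ l, x ∈ X) → B κ l ∈ X) →
        IsEmpty (LosingTree G K δ.1.toZFSet []) := by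
  classical
  -- One tree per `δ` is fixed for all `l`, so these are the demands of a single strategy. The
  -- default `∅` imposes no restriction.
  let ν : List ZFSet.{u} → Set.Iio (ω_ 1 : Ordinal.{u}) → ZFSet.{u} := fun l δ =>
    if h : Nonempty (LosingTree G K δ.1.toZFSet []) then
      LosingTree.lowerBound (h.some.subtree l) else ∅
  have hex : ∀ (κ : ZFSet.{u}) (l : List ZFSet.{u}), ∃ ξ, κ ∈ K →
      ξ ∈ κ ∧ ∀ δ, ν l δ ∈ κ → ξ ∉ ν l δ := by
    intro κ l
    by_cases hκ : κ ∈ K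
    · obtain ⟨ξ, hξ, h⟩ := exists_forall_notMem (hK κ hκ) (fun h => hω₁ (h ▸ hκ)) (ν l)
      exact ⟨ξ, fun _ => ⟨hξ, h⟩⟩
    · exact ⟨∅, fun h => absurd h hκ⟩
  choose B hB using hex
  refine ⟨B, fun δ X hδX hX hXδ hBX => ?_⟩
  by_contra hne
  rw [not_isEmpty_iff] at hne
  refine LosingTree.false_of_closedUnder hδX hX hXδ hne.some (fun κ hκ hκX l hl => ?_)
    hne.some rfl (by simp)
  have hν : ν l δ = LosingTree.lowerBound (hne.some.subtree l) := dif_pos hne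
  exact ⟨B κ l, hBX κ hκ hκX l hl, (hB κ l hκ).1, hν ▸ (hB κ l hκ).2 δ⟩

/-- If every answer left player I a tree, these trees could be glued below the move `(κ, ν)`. -/
theorem exists_answer (hl : IsEmpty (LosingTree G K δ l)) {κ ν : ZFSet.{u}} (hκ : κ ∈ K)
    (hκl : κ ∈ closureUnder G (δ ∪ {x | x ∈ l})) (hν : ν ∈ κ) :
    ∃ ξ ∈ κ \ ν, IsEmpty (LosingTree G K δ (ξ :: l)) := by
  by_contra! h
  exact hl.false (.move l κ ν hκ hκl hν fun ξ hξ => (h ξ hξ).some)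

end LosingTree

/-! ### The strategy of player II -/

/-- An answer to the move `m` that leaves player I without a losing tree, if there is one. -/
noncomputable def safeAnswer (G : Finset ZFSet.{u} → Set ZFSet.{u}) (K : ZFSet.{u})
    (δ : Set ZFSet.{u}) (l : List ZFSet.{u}) (m : ZFSet.{u} × ZFSet.{u}) : ZFSet.{u} :=
  Classical.epsilon fun ξ => ξ ∈ m.1 \ m.2 ∧ IsEmpty (LosingTree G K δ (ξ :: l))

/-- The list of safe answers to a list of moves, the latest one first. -/
noncomputable def safeAnswers (G : Finset ZFSet.{u} → Set ZFSet.{u}) (K : ZFSet.{u}) (δ : Set ZFSet.{u})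
    (ms : List (ZFSet.{u} × ZFSet.{u})) : List ZFSet.{u} :=
  ms.foldl (fun l m => safeAnswer G K δ l m :: l) []

/-- The strategy that always gives safe answers. -/
noncomputable def safeStrategy (G : Finset ZFSet.{u} → Set ZFSet.{u}) (K : ZFSet.{u}) (δ : Set ZFSet.{u}) :
    Strategy.{u} :=
  fun ms => (safeAnswers G K δ ms).headI

section Strategy

variable {G : Finset ZFSet.{u} → Set ZFSet.{u}} {K : ZFSet.{u}} {δ : Set ZFSet.{u}}

theorem safeAnswers_range_succ (p : ℕ → ZFSet.{u} × ZFSet.{u}) (n : ℕ) :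
    safeAnswers G K δ ((List.range (n + 1)).map p) =
      (safeStrategy G K δ).answers p n :: safeAnswers G K δ ((List.range n).map p) := by
  simp [safeAnswers, safeStrategy, Strategy.answers, List.range_succ]

theorem answers_safeStrategy (p : ℕ → ZFSet.{u} × ZFSet.{u}) (n : ℕ) :
    (safeStrategy G K δ).answers p n =
      safeAnswer G K δ (safeAnswers G K δ ((List.range n).map p)) (p n) := by
  simp [safeAnswers, safeStrategy, Strategy.answers, List.range_succ]

theorem hull_subset {X N : Set ZFSet.{u}} {ξ : ZFSet.{u}}
    (hX : ∀ f ∈ X, ∀ x ∈ X, IsFunction f → ∀ y, ZFSet.pair x y ∈ f → y ∈ X)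
    (hN : N ⊆ X) (hξ : ξ ∈ X) : hull N ξ ⊆ X := by
  rintro y ⟨f, hf, hfun, hy⟩
  exact hX f (hN hf) ξ hξ hfun y hy

theorem isFunction_prod_singleton (x y : ZFSet.{u}) : IsFunction (ZFSet.prod x {y}) := by
  refine ⟨fun p hp => ?_, fun a b c hb hc => ?_⟩
  · obtain ⟨a, -, b, -, rfl⟩ := ZFSet.mem_prod.1 hp
    exact ⟨a, b, rfl⟩
  · rw [ZFSet.pair_mem_prod, ZFSet.mem_singleton] at hb hc
    exact hb.2.trans hc.2.symm

/-- Each model satisfies `δ ⊆ M ⊆ N n ⊆ cl_G(δ ∪ answers)`. Without a tree there is no escape leaf,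
so the right-hand side adds no countable ordinal and `N n ∩ ω₁ = δ` throughout. -/
theorem isWinning_safeStrategy {M : Set ZFSet.{u}}
    (hG : ∀ X, ClosedUnder G X →
      ∀ f ∈ X, ∀ x ∈ X, IsFunction f → ∀ y, ZFSet.pair x y ∈ f → y ∈ X)
    (hδ : δ ⊆ omegaOne) (hδM : δ ⊆ M) (hM : M ⊆ closureUnder G δ)
    (hMK : ∀ y ∈ M, ZFSet.prod (ZFSet.sUnion K) {y} ∈ M)
    (hsafe : IsEmpty (LosingTree G K δ [])) : (safeStrategy G K δ).IsWinning M K := by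
  intro p
  set ξ := (safeStrategy G K δ).answers p with hξdef
  let l : ℕ → List ZFSet.{u} := fun n => safeAnswers G K δ ((List.range n).map p)
  let N : ℕ → Set ZFSet.{u} := runModel M ξ
  have hlsucc : ∀ n, l (n + 1) = ξ n :: l n := safeAnswers_range_succ p
  have hstep : ∀ n, IsEmpty (LosingTree G K δ (l n)) → N n ⊆ closureUnder G (δ ∪ {x | x ∈ l n}) →
      LegalI K (N n) (p n) →
      ξ n ∈ (p n).1 \ (p n).2 ∧ IsEmpty (LosingTree G K δ (l (n + 1))) := by
    intro n h1 h2 h3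
    rw [hlsucc]
    have := Classical.epsilon_spec (exists_answer h1 h3.1 (h2 h3.2.1) h3.2.2)
    rw [hξdef, answers_safeStrategy]
    exact this
  have hmain : ∀ n, (∀ i < n, LegalI K (N i) (p i)) → IsEmpty (LosingTree G K δ (l n)) ∧
      N n ⊆ closureUnder G (δ ∪ {x | x ∈ l n}) ∧ M ⊆ N n := by
    intro n
    induction n with
    | zero =>
      intro _
      refine ⟨hsafe, hM.trans ?_, Subset.rfl⟩
      exact closureUnder_subset (subset_union_left.trans subset_closureUnder)
        closedUnder_closureUnder
    | succ n ih =>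
      intro h
      obtain ⟨h1, h2, h3⟩ := ih fun i hi => h i (hi.trans (Nat.lt_succ_self n))
      obtain ⟨h4, h5⟩ := hstep n h1 h2 (h n (Nat.lt_succ_self n))
      refine ⟨h5, ?_, ?_⟩
      · refine hull_subset (hG _ closedUnder_closureUnder) (h2.trans ?_) ?_
        · refine closureUnder_subset (Subset.trans ?_ subset_closureUnder)
            closedUnder_closureUnder
          rw [hlsucc]
          exact union_subset_union_right _ fun x hx => List.mem_cons_of_mem _ hx
        · refine subset_closureUnder (Or.inr ?_)
          rw [hlsucc]
          exact List.mem_cons_self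
      · intro y hy
        -- An element `y` of `M` survives as the value at `ξ n` of the constant function `sup K ×
        -- {y}`; its domain contains `ξ n` because `ξ n ∈ κ ∈ K`.
        refine ⟨_, h3 (hMK y hy), isFunction_prod_singleton _ _, ?_⟩
        rw [ZFSet.pair_mem_prod]
        exact ⟨ZFSet.mem_sUnion_of_mem (ZFSet.mem_sdiff.1 h4).1 (h n (Nat.lt_succ_self n)).1,
          ZFSet.mem_singleton.2 rfl⟩
  have hinter : ∀ n, (∀ i < n, LegalI K (N i) (p i)) → N n ∩ omegaOne = δ := by
    intro n h
    obtain ⟨h1, h2, h3⟩ := hmain n h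
    refine Subset.antisymm ?_ (subset_inter (hδM.trans h3) hδ)
    by_contra h4
    exact h1.false (.escape _ fun h5 => h4 ((inter_subset_inter_left _ h2).trans h5))
  intro n h
  have hn : ∀ i < n, LegalI K (N i) (p i) := fun i hi => h i hi.le
  obtain ⟨h1, h2, -⟩ := hmain n hn
  refine ⟨(hstep n h1 h2 (h n le_rfl)).1, ?_⟩
  exact (hinter (n + 1) fun i hi => h i (Nat.lt_succ_iff.1 hi)).trans (hinter n hn).symm

end Strategy

/-! ### Winning models form a projective stationary set -/

instance : setLanguage.IsRelational := fun _ => inferInstanceAs (IsEmpty Empty)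

theorem card_setLanguage_le : setLanguage.card ≤ ℵ₀ := by
  have : Countable (Σ n, setLanguage.Relations n) := by
    refine Function.Injective.countable (β := Unit) (f := fun _ => ()) ?_
    rintro ⟨_, ⟨⟩⟩ ⟨_, ⟨⟩⟩ _
    rfl
  have h2 : IsEmpty (Σ n, setLanguage.Functions n) := ⟨fun x => isEmptyElim x.2⟩
  rw [FirstOrder.Language.card, FirstOrder.Language.Symbols, Cardinal.mk_le_aleph0_iff]
  infer_instance

theorem exists_operation_isElementarySubmodel (θ : Cardinal.{u}) (hne : (hereditary θ).Nonempty) :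
    ∃ F : Finset ZFSet.{u} → Set ZFSet.{u}, (∀ e, (F e).Countable) ∧
      (∀ e, F e ⊆ hereditary θ) ∧
      ∀ X ⊆ hereditary θ, ClosedUnder F X → IsElementarySubmodel θ X := by
  classical
  have := hne.to_subtype
  obtain ⟨F, hF, hFX⟩ := exists_operation_elementary card_setLanguage_le (hereditary θ)
  -- To act on all sets, the operation discards the members of `e` outside `H_θ`.
  refine ⟨fun e => Subtype.val '' F (e.subtype (· ∈ hereditary θ)), fun e => (hF _).image _,
    fun e => ?_, fun X hXθ hX => ?_⟩
  · rintro _ ⟨x, -, rfl⟩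
    exact x.2
  · obtain ⟨N, hN⟩ := hFX (Subtype.val ⁻¹' X) (by
      intro e he x hx
      refine hX (e.map (Function.Embedding.subtype _)) ?_ ⟨x, ?_, rfl⟩
      · intro y hy
        obtain ⟨z, hz, rfl⟩ := Finset.mem_map.1 (Finset.mem_coe.1 hy)
        exact he hz
      · have he' : (e.map (Function.Embedding.subtype _)).subtype (· ∈ hereditary θ) = e := by
          ext; simp
        rwa [he'])
    refine ⟨N, ?_⟩
    rw [hN, Subtype.image_preimage_coe, inter_eq_right.2 hXθ]

theorem IsElementarySubmodel.subset {θ : Cardinal.{u}} {M : Set ZFSet.{u}}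
    (hM : IsElementarySubmodel θ M) : M ⊆ hereditary θ := by
  obtain ⟨N, rfl⟩ := hM
  rintro _ ⟨x, -, rfl⟩
  exact x.2

theorem IsElementarySubmodel.infinite {θ : Cardinal.{u}} (hθ : (hereditary θ).Infinite)
    {M : Set ZFSet.{u}} (hM : IsElementarySubmodel θ M) : M.Infinite := by
  obtain ⟨N, rfl⟩ := hM
  have := hθ.to_subtype
  have hN : Infinite N := N.elementarilyEquivalent.infinite_iff.2 this
  exact (Set.infinite_coe_iff.1 hN).image Subtype.val_injective.injOn

/-- Adjoins the set `s`, the values of functions and the functions with domain `s` that are constant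
to the operation `F`. -/
def functionOperation (F : Finset ZFSet.{u} → Set ZFSet.{u}) (s : ZFSet.{u})
    (e : Finset ZFSet.{u}) : Set ZFSet.{u} :=
  F e ∪ ({s} ∪ ({y | ∃ f ∈ e, ∃ x ∈ e, IsFunction f ∧ ZFSet.pair x y ∈ f} ∪
    (fun y => ZFSet.prod s {y}) '' e))

section FunctionOperation

variable {F : Finset ZFSet.{u} → Set ZFSet.{u}} {s : ZFSet.{u}} {X : Set ZFSet.{u}}

theorem countable_functionOperation (hF : ∀ e, (F e).Countable) (e : Finset ZFSet.{u}) :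
    (functionOperation F s e).Countable := by
  refine (hF e).union ((countable_singleton s).union (Countable.union ?_
    ((Finset.countable_toSet e).image _)))
  have h : {y | ∃ f ∈ e, ∃ x ∈ e, IsFunction f ∧ ZFSet.pair x y ∈ f} =
      ⋃ f ∈ (e : Set ZFSet.{u}), ⋃ x ∈ (e : Set ZFSet.{u}),
        {y | IsFunction f ∧ ZFSet.pair x y ∈ f} := by
    ext
    simp only [mem_iUnion, mem_ofPred_eq, Finset.mem_coe, exists_prop]
  rw [h]
  refine (Finset.countable_toSet e).biUnion fun f _ => (Finset.countable_toSet e).biUnion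
    fun x _ => Set.Subsingleton.countable ?_
  rintro y ⟨hf, hy⟩ z ⟨-, hz⟩
  exact hf.2 x y z hy hz

theorem ClosedUnder.of_functionOperation (hX : ClosedUnder (functionOperation F s) X) :
    ClosedUnder F X :=
  hX.mono fun _ => subset_union_left

theorem ClosedUnder.mem_of_functionOperation (hX : ClosedUnder (functionOperation F s) X) :
    s ∈ X :=
  hX ∅ (by simp) (Or.inr (Or.inl rfl))

theorem ClosedUnder.apply_mem (hX : ClosedUnder (functionOperation F s) X) {f x y : ZFSet.{u}}
    (hf : f ∈ X) (hx : x ∈ X) (hfun : IsFunction f) (hy : ZFSet.pair x y ∈ f) : y ∈ X := by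
  classical
  refine hX {f, x} ?_ (Or.inr (Or.inr (Or.inl ⟨f, by simp, x, by simp, hfun, hy⟩)))
  simpa [insert_subset_iff] using ⟨hf, hx⟩

theorem ClosedUnder.prod_singleton_mem (hX : ClosedUnder (functionOperation F s) X)
    {y : ZFSet.{u}} (hy : y ∈ X) : ZFSet.prod s {y} ∈ X :=
  hX {y} (by simpa using hy) (Or.inr (Or.inr (Or.inr ⟨y, by simp, rfl⟩)))

theorem mem_hereditary_of_pair_mem {θ : Cardinal.{u}} {x y f : ZFSet.{u}}
    (hf : f ∈ hereditary θ) (h : ZFSet.pair x y ∈ f) : y ∈ hereditary θ := by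
  have h1 : ({x, y} : ZFSet) ∈ ZFSet.pair x y := by simp [ZFSet.pair]
  exact mem_hereditary_of_mem (mem_hereditary_of_mem (mem_hereditary_of_mem hf h) h1) (by simp)

theorem closedUnder_functionOperation_hereditary {θ : Cardinal.{u}} (hθ : θ.IsRegular)
    (hθ' : ℵ₀ < θ) (hs : s ∈ hereditary θ) (hF : ∀ e, F e ⊆ hereditary θ) :
    ClosedUnder (functionOperation F s) (hereditary θ) := by
  intro e he
  refine union_subset (hF e) (union_subset (singleton_subset_iff.2 hs) (union_subset ?_ ?_))
  · rintro y ⟨f, hf, x, -, -, hy⟩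
    exact mem_hereditary_of_pair_mem (he hf) hy
  · rintro _ ⟨y, hy, rfl⟩
    exact prod_singleton_mem_hereditary hθ hθ' hs (he hy)

end FunctionOperation

/-- Adjoins the values of `B` at elements and lists to the operation `G`. -/
def listOperation (G : Finset ZFSet.{u} → Set ZFSet.{u})
    (B : ZFSet.{u} → List ZFSet.{u} → ZFSet.{u}) (e : Finset ZFSet.{u}) : Set ZFSet.{u} :=
  G e ∪ range fun q : e × List e => B q.1.1 (q.2.map Subtype.val)

theorem countable_listOperation {G : Finset ZFSet.{u} → Set ZFSet.{u}}
    (hG : ∀ e, (G e).Countable) (B : ZFSet.{u} → List ZFSet.{u} → ZFSet.{u})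
    (e : Finset ZFSet.{u}) : (listOperation G B e).Countable :=
  (hG e).union (countable_range _)

theorem ClosedUnder.listOperation_mem {G : Finset ZFSet.{u} → Set ZFSet.{u}}
    {B : ZFSet.{u} → List ZFSet.{u} → ZFSet.{u}} {X : Set ZFSet.{u}}
    (hX : ClosedUnder (listOperation G B) X) {κ : ZFSet.{u}} (hκ : κ ∈ X) {l : List ZFSet.{u}}
    (hl : ∀ x ∈ l, x ∈ X) : B κ l ∈ X := by
  classical
  refine hX (insert κ l.toFinset) ?_ (Or.inr ⟨⟨⟨κ, by simp⟩,
    l.attach.map fun x => ⟨x.1, by simp [x.2]⟩⟩, ?_⟩)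
  · intro x hx
    rcases Finset.mem_insert.1 (Finset.mem_coe.1 hx) with rfl | hx
    · exact hκ
    · exact hl x (List.mem_toFinset.1 hx)
  · simp [Function.comp_def]

theorem winningModels_subset {θ : Cardinal.{u}} (hθ : θ.IsRegular) (hθ' : ℵ₀ < θ)
    (K : ZFSet.{u}) : winningModels θ K ⊆ countableSubsets (hereditary θ) := by
  obtain ⟨a, ha⟩ := countableSubsets_hereditary_nonempty hθ hθ'
  exact fun M hM => ⟨hM.2.1.subset, hM.1, hM.2.1.infinite (ha.2.2.mono ha.1)⟩

end NambaGame

open NambaGame in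
theorem mainTheorem3 (θ : Cardinal.{u}) (hθ : θ.IsRegular) (hθ' : Cardinal.aleph0 < θ)
    (K : ZFSet.{u}) (hKθ : K ∈ NambaGame.hereditary θ)
    (hK : ∀ κ ∈ K, NambaGame.IsUncountableRegular κ) (hω₁ : NambaGame.omegaOne ∉ K) :
    NambaGame.IsProjectiveStationary (NambaGame.hereditary θ) (NambaGame.winningModels θ K) := by
  refine ⟨winningModels_subset hθ hθ' K, fun S hS =>
    ⟨fun M hM => winningModels_subset hθ hθ' K hM.1, fun C hC => ?_⟩⟩
  have hne := countableSubsets_hereditary_nonempty hθ hθ'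
  obtain ⟨F₁, hF₁, hF₁C⟩ := hC.exists_operation hne
  obtain ⟨F₂, hF₂, hF₂θ, hF₂el⟩ := exists_operation_isElementarySubmodel θ
    (hne.some_mem.2.2.mono hne.some_mem.1).nonempty
  let F : Finset ZFSet.{u} → Set ZFSet.{u} := fun e => F₁ e ∪ F₂ e
  let G := functionOperation F (ZFSet.sUnion K)
  have hG : ∀ e, (G e).Countable :=
    countable_functionOperation fun e => (hC.subset (hF₁ e)).2.1.union (hF₂ e)
  obtain ⟨B, hB⟩ := exists_bounds G hK hω₁
  -- The closure under both `G` and `B` only certifies that `δ` has no tree; the model itself is the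
  -- smaller closure under `G`, the operation for which the trees and `B` were defined.
  obtain ⟨δ, hδS, hδ⟩ := hS (isClub_closurePoints (countable_listOperation hG B))
  have hδω : (δ.1.toZFSet : Set ZFSet.{u}) ⊆ omegaOne := toZFSet_subset_omegaOne δ.2
  have hcl := closedUnder_closureUnder (G := listOperation G B)
    (X := (δ.1.toZFSet : Set ZFSet.{u}))
  have hclG : ClosedUnder G (closureUnder (listOperation G B) δ.1.toZFSet) :=
    hcl.mono fun _ => Set.subset_union_left
  have hsafe : IsEmpty (LosingTree G K δ.1.toZFSet []) :=
    hB δ _ subset_closureUnder hclG hδ fun κ _ hκ l hl => hcl.listOperation_mem hκ hl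
  have hM := closedUnder_closureUnder (G := G) (X := (δ.1.toZFSet : Set ZFSet.{u}))
  have hMc : (closureUnder G (δ.1.toZFSet : Set ZFSet.{u})).Countable :=
    countable_closureUnder hG (countable_mem_toZFSet δ.2)
  have hMθ : closureUnder G (δ.1.toZFSet : Set ZFSet.{u}) ⊆ hereditary θ :=
    closureUnder_subset (hδω.trans (omegaOne_subset_hereditary hθ hθ'))
      (closedUnder_functionOperation_hereditary hθ hθ' (sUnion_mem_hereditary hKθ)
        fun e => Set.union_subset (hC.subset (hF₁ e)).1 (hF₂θ e))
  have hMF := hM.of_functionOperation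
  refine ⟨closureUnder G δ.1.toZFSet, ⟨⟨hMc, hF₂el _ hMθ (hMF.mono fun _ =>
    Set.subset_union_right), hM.mem_of_functionOperation, safeStrategy G K δ.1.toZFSet, ?_⟩,
    δ, hδS, ?_⟩, hF₁C _ hMθ hMc (hMF.mono fun _ => Set.subset_union_left)⟩
  · exact isWinning_safeStrategy (fun X hX f hf x hx hfun y hy => hX.apply_mem hf hx hfun hy)
      hδω subset_closureUnder Set.Subset.rfl (fun y hy => hM.prod_singleton_mem hy) hsafe
  · refine Set.Subset.antisymm ?_ (Set.subset_inter subset_closureUnder hδω)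
    -- The model is contained in the larger closure, whose countable ordinals all lie in `δ`.
    exact (Set.inter_subset_inter_left _ (closureUnder_subset subset_closureUnder hclG)).trans hδ
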